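/- Let $q$ be a prime power and let $n>s\ge 1$ and $r>h\ge 1$ be integers. For $i\ge 0$ write $[i]_q=\frac{q^i-1}{q-1}$ and, for positive integers $k,d$, write $g_q(k,d)=\sum_{i=0}^{k-1}\lceil d/q^i\rceil$ for the Griesmer bound. A projective $h-(n',r,s')_q$ system is a multiset of $n'$ subspaces of $\mathbb{F}_q^r$ of (vector space) dimension at most $h$ such that every hyperplane (i.e. $(r-1)$-dimensional subspace) of $\mathbb{F}_q^r$ contains at most $s'$ elements of the multiset (counted with multiplicity) and some hyperplane contains exactly $s'$ of them; it is called faithful if all its elements have dimension exactly $h$. Suppose that the surplus $$\theta(n,r,s,h,q):=n\,[h]_q-g_q\!\left(r,\;q^{h-1}(n-s)\right)$$ is nonnegative. Then for all sufficiently large integers $t$ there exists a faithful projective $$h-\left(n+t\cdot\frac{[r]_q}{[\gcd(r,h)]_q},\; r,\; s+t\cdot\frac{[r-h]_q}{[\gcd(r,h)]_q}\right)_q$$ system. -/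

import Mathlib

/-- The number `[i]_q = (q ^ i - 1) / (q - 1)` of points of an `i`-space over the field with `q`
elements (the division is exact for `q ≥ 2`, and `[0]_q = 0`). -/
def qNum (q i : ℕ) : ℕ := (q ^ i - 1) / (q - 1)

theorem qNum_eq_sum {q : ℕ} (hq : 2 ≤ q) (i : ℕ) :
    qNum q i = ∑ j ∈ Finset.range i, q ^ j := (Nat.geomSum_eq hq i).symm

/-- The quotients `[b]_q / [a]_q` with `a ∣ b` are exact. -/
theorem qNum_dvd_qNum {q a b : ℕ} (hq : 2 ≤ q) (hab : a ∣ b) : qNum q a ∣ qNum q b := by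
  have hpos : 0 < q - 1 := by omega
  have key : ∀ i, qNum q i * (q - 1) = q ^ i - 1 := fun i =>
    Nat.div_mul_cancel (by simpa using Nat.sub_dvd_pow_sub_pow q 1 i)
  refine Nat.dvd_of_mul_dvd_mul_right hpos ?_
  rw [key, key]
  obtain ⟨c, rfl⟩ := hab
  simpa [pow_mul] using Nat.sub_dvd_pow_sub_pow (q ^ a) 1 c

/-- The Griesmer bound `g_q(k, d) = ∑_{i=0}^{k-1} ⌈d / q ^ i⌉`. -/
def griesmer (q k d : ℕ) : ℕ := ∑ i ∈ Finset.range k, d ⌈/⌉ (q ^ i)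

/-- The surplus `θ(n, r, s, h, q) = n [h]_q - g_q(r, q ^ (h - 1) (n - s))`, an integer;
it is used for `n > s ≥ 1` and `r > h ≥ 1`, where no natural subtraction truncates. -/
def surplus (n r s h q : ℕ) : ℤ :=
  ((n * qNum q h : ℕ) : ℤ) - ((griesmer q r (q ^ (h - 1) * (n - s)) : ℕ) : ℤ)

open Classical in
/-- The number of elements (with multiplicity) of the multiset `S` of subspaces of `F ^ r`
that are contained in the subspace `H`. -/
noncomputable def numContained {F : Type*} [Field F] {r : ℕ}
    (S : Multiset (Submodule F (Fin r → F))) (H : Submodule F (Fin r → F)) : ℕ :=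
  S.countP (fun U => U ≤ H)

/-- `S` is a projective `h-(n, r, s)_q` system, where `F` is the field with `q` elements: a
multiset of `n` subspaces of `F ^ r` of dimension at most `h` such that each hyperplane contains
at most `s` elements of `S` and some hyperplane contains exactly `s` elements of `S`. -/
structure IsProjectiveSystem (F : Type*) [Field F] (h n r s : ℕ)
    (S : Multiset (Submodule F (Fin r → F))) : Prop where
  card_eq : Multiset.card S = n
  finrank_le : ∀ U ∈ S, Module.finrank F U ≤ h
  le_of_hyperplane : ∀ H : Submodule F (Fin r → F), Module.finrank F H + 1 = r →
    numContained S H ≤ s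
  exists_hyperplane : ∃ H : Submodule F (Fin r → F), Module.finrank F H + 1 = r ∧
    numContained S H = s

/-- A projective `h-(n, r, s)_q` system is faithful if all of its elements have dimension `h`. -/
structure IsFaithfulProjectiveSystem (F : Type*) [Field F] (h n r s : ℕ)
    (S : Multiset (Submodule F (Fin r → F))) : Prop
    extends IsProjectiveSystem F h n r s S where
  finrank_eq : ∀ U ∈ S, Module.finrank F U = h

/-! ### Arithmetic of `q`-numbers and of the Griesmer bound -/

/-! Put `k = r - h`, `m = n - s`. Nonnegative surplus means exactly `∑_{j<k} ⌈m / q^(j+1)⌉ ≤ s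
[h]_q`. Integer, possibly negative, multiplicities on the `h`-subspaces are allowed at first. A
single flag then supplies an `f` of total weight `n` and weight at most `s` in each hyperplane
(`exists_combination_of_sum_le`). It also supplies a signed `D` with total `[r]_q / [g]_q` and
hyperplane weights at most `[k]_q / [g]_q`, where `g = gcd(r, h)` (`exists_design_combination`).

Summing the translates of `D` under the general linear group gives a constant combination `C` with
positive coefficients. For large `t`, the sum of `f` and a combination of `D` and `C` worth `t`
copies of `D` is therefore nonnegative, hence a genuine multiset
(`eventually_exists_nonneg_combination`). Finally, elements are replaced by one inside a fixed
hyperplane until the upper bound is attained. -/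

theorem qNum_zero (q : ℕ) : qNum q 0 = 0 := by simp [qNum]

theorem qNum_one {q : ℕ} (hq : 2 ≤ q) : qNum q 1 = 1 := by simp [qNum_eq_sum hq]

theorem qNum_succ {q : ℕ} (hq : 2 ≤ q) (i : ℕ) : qNum q (i + 1) = qNum q i + q ^ i := by
  simp [qNum_eq_sum hq, Finset.sum_range_succ]

theorem qNum_succ' {q : ℕ} (hq : 2 ≤ q) (i : ℕ) : qNum q (i + 1) = q * qNum q i + 1 := by
  simp [qNum_eq_sum hq, Finset.sum_range_succ', Finset.mul_sum, pow_succ']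

theorem qNum_add {q : ℕ} (hq : 2 ≤ q) (i j : ℕ) :
    qNum q (i + j) = qNum q i + q ^ i * qNum q j := by
  simp [qNum_eq_sum hq, Finset.sum_range_add, Finset.mul_sum, pow_add]

theorem qNum_pos {q : ℕ} (hq : 2 ≤ q) {i : ℕ} (hi : 1 ≤ i) : 0 < qNum q i := by
  obtain ⟨j, rfl⟩ := Nat.exists_eq_add_of_le' hi
  rw [qNum_succ' hq]; omega

theorem mul_ceilDiv_mul {a : ℕ} (ha : 0 < a) (m b : ℕ) : (a * m) ⌈/⌉ (a * b) = m ⌈/⌉ b := by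
  rcases Nat.eq_zero_or_pos b with rfl | hb
  · simp
  · refine eq_of_forall_ge_iff fun c => ?_
    rw [ceilDiv_le_iff_le_mul (Nat.mul_pos ha hb), ceilDiv_le_iff_le_mul hb, mul_assoc]
    exact Nat.mul_le_mul_left_iff ha

/-- The first `h + 1` ceilings are exact divisions. In the application `h + 1` is the dimension of
the elements, so this block cancels against `n [h + 1]_q` up to `s [h + 1]_q`. -/
theorem griesmer_pow_mul {q : ℕ} (hq : 2 ≤ q) (h k m : ℕ) :
    griesmer q (h + 1 + k) (q ^ h * m) =
      qNum q (h + 1) * m + ∑ j ∈ Finset.range k, m ⌈/⌉ q ^ (j + 1) := by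
  have hq0 : 0 < q := by omega
  rw [griesmer, Finset.sum_range_add]
  congr 1
  · rw [qNum_eq_sum hq, Finset.sum_mul, ← Finset.sum_range_reflect]
    refine Finset.sum_congr rfl fun i hi => ?_
    have hi' : i ≤ h := by simpa [Nat.lt_succ_iff] using hi
    have e : h + 1 - 1 - i = h - i := by omega
    have e2 : q ^ h * m = q ^ (h - i) * (q ^ i * m) := by
      rw [← mul_assoc, ← pow_add, Nat.sub_add_cancel hi']
    rw [e, e2]
    nth_rewrite 2 [← mul_one (q ^ (h - i))]
    rw [mul_ceilDiv_mul (by positivity), ceilDiv_one]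
  · refine Finset.sum_congr rfl fun j _ => ?_
    rw [show h + 1 + j = h + (j + 1) by ring, pow_add, mul_ceilDiv_mul (by positivity)]

/-! ### Counting subspaces -/

section Counting

variable {F : Type*} [Field F]
variable {V : Type*} [AddCommGroup V] [Module F V]

theorem card_finrank_eq_one [Finite F] :
    Nat.card {U : Submodule F V // Module.finrank F U = 1} =
      qNum (Nat.card F) (Module.finrank F V) := by
  have hq : 2 ≤ Nat.card F := Finite.one_lt_card
  rw [← Nat.card_congr (Projectivization.equivSubmodule F V),
    Projectivization.card_of_finrank F V rfl, qNum_eq_sum hq]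

theorem card_le_finrank_eq (W : Submodule F V) (d : ℕ) :
    Nat.card {U : Submodule F V // U ≤ W ∧ Module.finrank F U = d} =
      Nat.card {U : Submodule F W // Module.finrank F U = d} := by
  refine (Nat.card_congr ((W.mapIic.toEquiv.subtypeEquiv
    (q := fun U : Set.Iic W => Module.finrank F U.1 = d) fun U => ?_).trans
    (Equiv.subtypeSubtypeEquivSubtypeInter (fun U => U ≤ W) (fun U => Module.finrank F U = d)))).symm
  change _ ↔ Module.finrank F (U.map W.subtype) = d
  rw [Submodule.finrank_map_subtype_eq]

variable [Finite F] [FiniteDimensional F V]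

/-- By duality, hyperplanes correspond to points of the dual space. -/
theorem card_finrank_eq_of_add_one_eq {d : ℕ} (hd : d + 1 = Module.finrank F V) :
    Nat.card {U : Submodule F V // Module.finrank F U = d} = qNum (Nat.card F) (d + 1) := by
  rw [hd, ← Subspace.dual_finrank_eq (K := F) (V := V), ← card_finrank_eq_one]
  refine Nat.card_congr (((Subspace.orderIsoFiniteDimensional (K := F)
    (V := V)).toEquiv.trans OrderDual.ofDual).subtypeEquiv fun U => ?_)
  have := Subspace.finrank_add_finrank_dualAnnihilator_eq (K := F) U
  change _ ↔ Module.finrank F (Submodule.dualAnnihilator U) = 1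
  omega

/-- These subspaces correspond to the points of `E / A`. -/
theorem card_between_finrank_eq {A E : Submodule F V} (h : A ≤ E) :
    Nat.card {U : Submodule F V // (A ≤ U ∧ U ≤ E) ∧
      Module.finrank F U = Module.finrank F A + 1} =
      qNum (Nat.card F) (Module.finrank F E - Module.finrank F A) := by
  have key : ∀ L : Submodule F (V ⧸ A),
      Module.finrank F (L.comap A.mkQ) = Module.finrank F L + Module.finrank F A := by
    intro L
    have := LinearMap.finrank_range_add_finrank_ker (A.mkQ.domRestrict (L.comap A.mkQ))
    rw [LinearMap.range_domRestrict, Submodule.map_comap_eq_of_surjective A.mkQ_surjective,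
      LinearMap.ker_domRestrict, Submodule.ker_mkQ] at this
    rw [← this]
    exact congrArg _ (Submodule.submoduleOfEquivOfLe (A.le_comap_mkQ L)).finrank_eq
  have hE : (E.map A.mkQ).comap A.mkQ = E := by
    rw [Submodule.comap_map_mkQ, sup_eq_right.2 h]
  have hfin : Module.finrank F (E.map A.mkQ) = Module.finrank F E - Module.finrank F A := by
    have := key (E.map A.mkQ)
    rw [hE] at this
    omega
  rw [← hfin, ← card_finrank_eq_one, ← card_le_finrank_eq]
  refine (Nat.card_congr (((Submodule.comapMkQRelIso A).toEquiv.subtypeEquiv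
    (q := fun U : Set.Ici A => U.1 ≤ E ∧ Module.finrank F U.1 = Module.finrank F A + 1) fun L => ?_).trans
    ((Equiv.subtypeSubtypeEquivSubtypeInter (fun U => A ≤ U)
      (fun U => U ≤ E ∧ Module.finrank F U = Module.finrank F A + 1)).trans
      (Equiv.subtypeEquivRight fun U => and_assoc.symm)))).symm
  change _ ↔ L.comap A.mkQ ≤ E ∧ Module.finrank F (L.comap A.mkQ) = Module.finrank F A + 1
  have hL : L.comap A.mkQ ≤ E ↔ L ≤ E.map A.mkQ := by
    refine ⟨fun hL => ?_, fun hL => hE ▸ Submodule.comap_mono hL⟩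
    rw [← Submodule.map_comap_eq_of_surjective A.mkQ_surjective L]
    exact Submodule.map_mono hL
  rw [key, hL]
  exact and_congr_right' (by omega)

end Counting

/-! ### Integral combinations of `h`-subspaces -/

section Combinations

variable {F : Type*} [Field F] {V : Type*} [AddCommGroup V] [Module F V] {h : ℕ}

/-- The type of `h`-dimensional subspaces of `V`. -/
abbrev Grass (F V : Type*) [Field F] [AddCommGroup V] [Module F V] (h : ℕ) : Type _ :=
  {U : Submodule F V // Module.finrank F U = h}

open Classical in
/-- The total weight of the elements contained in `H` of an integral combination of
`h`-subspaces. -/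
noncomputable def weightIn [Fintype (Grass F V h)] (H : Submodule F V) :
    (Grass F V h → ℤ) →ₗ[ℤ] ℤ :=
  ∑ U : Grass F V h, if U.1 ≤ H then LinearMap.proj U else 0

open Classical in
theorem weightIn_apply [Fintype (Grass F V h)] (H : Submodule F V) (f : Grass F V h → ℤ) :
    weightIn H f = ∑ U : Grass F V h, if U.1 ≤ H then f U else 0 := by
  simp only [weightIn, LinearMap.sum_apply]
  exact Finset.sum_congr rfl fun U _ => by split_ifs <;> simp

theorem weightIn_top [Fintype (Grass F V h)] (f : Grass F V h → ℤ) :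
    weightIn ⊤ f = ∑ U : Grass F V h, f U := by
  simp [weightIn_apply]

open Classical in
/-- The sum of all `h`-subspaces between `A` and `E`. -/
noncomputable def interval (h : ℕ) (A E : Submodule F V) : Grass F V h → ℤ :=
  fun U => if A ≤ U.1 ∧ U.1 ≤ E then 1 else 0

theorem weightIn_interval [Fintype (Grass F V h)] (A E H : Submodule F V) :
    weightIn H (interval h A E) =
      Nat.card {U : Submodule F V // (A ≤ U ∧ U ≤ E ⊓ H) ∧ Module.finrank F U = h} := by
  classical
  rw [weightIn_apply]
  simp only [interval, ← ite_and]
  rw [Finset.sum_boole, ← Fintype.card_subtype, ← Nat.card_eq_fintype_card]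
  congr 1
  refine Nat.card_congr ((Equiv.subtypeSubtypeEquivSubtypeInter
    (fun U : Submodule F V => Module.finrank F U = h) (fun U => U ≤ H ∧ A ≤ U ∧ U ≤ E)).trans (Equiv.subtypeEquivRight fun U => ?_))
  rw [le_inf_iff]
  tauto

variable [FiniteDimensional F V]

theorem finrank_inf_hyperplane {E H : Submodule F V}
    (hH : Module.finrank F H + 1 = Module.finrank F V) (hE : ¬ E ≤ H) :
    Module.finrank F ↥(E ⊓ H) + 1 = Module.finrank F E := by
  have h1 := Submodule.finrank_sup_add_finrank_inf_eq E H
  have h2 : H < E ⊔ H := right_lt_sup.2 hE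
  have h3 := Submodule.finrank_lt_finrank_of_lt h2
  have h4 := Submodule.finrank_le (E ⊔ H)
  omega

variable [Finite F]

theorem weightIn_interval_of_le [Fintype (Grass F V h)] {A E H : Submodule F V}
    (hA : Module.finrank F A + 1 = h) (hAE : A ≤ E) (hAH : A ≤ H) :
    weightIn H (interval h A E) =
      qNum (Nat.card F) (Module.finrank F ↥(E ⊓ H) - Module.finrank F A) := by
  rw [weightIn_interval, ← card_between_finrank_eq (le_inf hAE hAH), hA]

omit [FiniteDimensional F V] [Finite F] in
theorem weightIn_interval_of_not_le [Fintype (Grass F V h)] {A E H : Submodule F V}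
    (hAH : ¬ A ≤ H) : weightIn H (interval h A E) = 0 := by
  rw [weightIn_interval, Nat.cast_eq_zero]
  have : IsEmpty {U : Submodule F V // (A ≤ U ∧ U ≤ E ⊓ H) ∧ Module.finrank F U = h} :=
    ⟨fun U => hAH (U.2.1.1.trans (U.2.1.2.trans inf_le_right))⟩
  exact Nat.card_of_isEmpty

theorem weightIn_interval_bot_of_le [Fintype (Grass F V h)] {W H : Submodule F V}
    (hW : h + 1 = Module.finrank F W) (hWH : W ≤ H) :
    weightIn H (interval h ⊥ W) = qNum (Nat.card F) (h + 1) := by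
  rw [weightIn_interval, inf_eq_left.2 hWH, ← card_finrank_eq_of_add_one_eq hW,
    ← card_le_finrank_eq]
  simp

omit [Finite F] in
theorem weightIn_interval_bot_of_not_le [Fintype (Grass F V h)] {W H : Submodule F V}
    (hW : h + 1 = Module.finrank F W) (hH : Module.finrank F H + 1 = Module.finrank F V)
    (hWH : ¬ W ≤ H) : weightIn H (interval h ⊥ W) = 1 := by
  have hWH' := finrank_inf_hyperplane hH hWH
  rw [weightIn_interval, Nat.cast_eq_one, Nat.card_eq_one_iff_exists]
  refine ⟨⟨W ⊓ H, ⟨bot_le, le_rfl⟩, by omega⟩, fun U => Subtype.ext ?_⟩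
  exact Submodule.eq_of_le_of_finrank_eq U.2.1.2 (by have := U.2.2; dsimp only; omega)

end Combinations

/-! ### Averaging over the general linear group -/

section Averaging

variable {F : Type*} [Field F] {V : Type*} [AddCommGroup V] [Module F V] {h : ℕ}

/-- The action of a linear automorphism on the `h`-subspaces. -/
noncomputable def grassEquiv (h : ℕ) (g : V ≃ₗ[F] V) : Grass F V h ≃ Grass F V h :=
  (Submodule.orderIsoMapComap g).toEquiv.subtypeEquiv fun U => by
    change _ ↔ Module.finrank F (U.map (g : V →ₗ[F] V)) = h
    rw [LinearEquiv.finrank_map_eq]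

theorem coe_grassEquiv (g : V ≃ₗ[F] V) (U : Grass F V h) :
    (grassEquiv h g U).1 = U.1.map (g : V →ₗ[F] V) := rfl

theorem grassEquiv_mul (g g' : V ≃ₗ[F] V) (U : Grass F V h) :
    grassEquiv h (g * g') U = grassEquiv h g (grassEquiv h g' U) :=
  Subtype.ext (Submodule.map_comp (g' : V →ₗ[F] V) (g : V →ₗ[F] V) U.1)

theorem weightIn_comp_grassEquiv [Fintype (Grass F V h)] (g : V ≃ₗ[F] V) (H : Submodule F V)
    (f : Grass F V h → ℤ) :
    weightIn H (fun U => f (grassEquiv h g U)) = weightIn (H.map (g : V →ₗ[F] V)) f := by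
  classical
  rw [weightIn_apply, weightIn_apply]
  refine Fintype.sum_equiv (grassEquiv h g) _ _ fun U => ?_
  rw [coe_grassEquiv, Submodule.map_le_map_iff_of_injective (f := (g : V →ₗ[F] V)) g.injective]

theorem exists_grassEquiv_eq [FiniteDimensional F V] (U U' : Grass F V h) :
    ∃ g : V ≃ₗ[F] V, grassEquiv h g U = U' := by
  obtain ⟨C, hC⟩ := U.1.exists_isCompl
  obtain ⟨C', hC'⟩ := U'.1.exists_isCompl
  have h1 := Submodule.finrank_add_eq_of_isCompl hC
  have h2 := Submodule.finrank_add_eq_of_isCompl hC'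
  have e1 : U.1 ≃ₗ[F] U'.1 := LinearEquiv.ofFinrankEq _ _ (U.2.trans U'.2.symm)
  have e2 : C ≃ₗ[F] C' := LinearEquiv.ofFinrankEq _ _ (by have := U.2; have := U'.2; omega)
  let g : V ≃ₗ[F] V := (Submodule.prodEquivOfIsCompl _ _ hC).symm ≪≫ₗ
    (LinearEquiv.prodCongr e1 e2) ≪≫ₗ Submodule.prodEquivOfIsCompl _ _ hC'
  have hle : U.1.map (g : V →ₗ[F] V) ≤ U'.1 := by
    rintro _ ⟨x, hx, rfl⟩
    have : g x = e1 ⟨x, hx⟩ := by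
      simp [g, Submodule.prodEquivOfIsCompl_symm_apply_left _ _ hC ⟨x, hx⟩]
    change g x ∈ U'.1
    rw [this]
    exact (e1 ⟨x, hx⟩).2
  exact ⟨g, Subtype.ext (Submodule.eq_of_le_of_finrank_eq hle
    ((grassEquiv h g U).2.trans U'.2.symm))⟩

/-- Automorphisms permute hyperplanes, so summing all translates of `D` preserves both conditions up
to the factor `K`, the group order. Transitivity on `h`-subspaces makes the sum constant, and its
positive total forces positive coefficients. -/
theorem exists_pos_combination [Finite F] [FiniteDimensional F V] [Fintype (Grass F V h)]
    {D : Grass F V h → ℤ} {x y : ℤ} (hy : 0 < y) (htop : weightIn ⊤ D = y)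
    (hle : ∀ H : Submodule F V, Module.finrank F H + 1 = Module.finrank F V → weightIn H D ≤ x) :
    ∃ (K : ℕ) (C : Grass F V h → ℤ), 0 < K ∧ (∀ U, 0 < C U) ∧ weightIn ⊤ C = K * y ∧
      ∀ H : Submodule F V, Module.finrank F H + 1 = Module.finrank F V → weightIn H C ≤ K * x := by
  have : Finite V := Module.finite_of_finite F
  have : Finite (V ≃ₗ[F] V) := Finite.of_injective _ DFunLike.coe_injective
  have := Fintype.ofFinite (V ≃ₗ[F] V)
  let C : Grass F V h → ℤ := ∑ g : V ≃ₗ[F] V, fun U => D (grassEquiv h g U)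
  have hC : ∀ H, weightIn H C = ∑ g : V ≃ₗ[F] V, weightIn (H.map (g : V →ₗ[F] V)) D := fun H => by
    rw [map_sum]
    exact Finset.sum_congr rfl fun g _ => weightIn_comp_grassEquiv g H D
  have hCtop : weightIn ⊤ C = Fintype.card (V ≃ₗ[F] V) * y := by
    have : ∀ g : V ≃ₗ[F] V, (⊤ : Submodule F V).map (g : V →ₗ[F] V) = ⊤ := fun g => by
      simp
    simp [hC, this, htop]
  have hconst : ∀ U U', C U' = C U := by
    intro U U'
    obtain ⟨d, rfl⟩ := exists_grassEquiv_eq U U'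
    simp only [C, Finset.sum_apply, ← grassEquiv_mul]
    exact Fintype.sum_equiv (Equiv.mulRight d) _ _ fun g => rfl
  refine ⟨Fintype.card (V ≃ₗ[F] V), C, Fintype.card_pos, fun U => ?_, hCtop, fun H hH => ?_⟩
  · have h1 : 0 < weightIn ⊤ C := hCtop ▸ mul_pos (by exact_mod_cast Fintype.card_pos) hy
    rw [weightIn_top, Finset.sum_congr rfl fun U' _ => hconst U U', Finset.sum_const,
      nsmul_eq_mul] at h1
    exact pos_of_mul_pos_right h1 (by positivity)
  · rw [hC]
    calc _ ≤ ∑ g : V ≃ₗ[F] V, x := Finset.sum_le_sum fun g _ => hle _ (by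
          rw [LinearEquiv.finrank_map_eq, hH])
      _ = _ := by simp

theorem eventually_exists_nonneg_combination [Finite F] [FiniteDimensional F V]
    [Fintype (Grass F V h)] {f D : Grass F V h → ℤ} {n s x y : ℤ} (hy : 0 < y)
    (hf : weightIn ⊤ f = n)
    (hf' : ∀ H : Submodule F V, Module.finrank F H + 1 = Module.finrank F V → weightIn H f ≤ s)
    (hD : weightIn ⊤ D = y)
    (hD' : ∀ H : Submodule F V, Module.finrank F H + 1 = Module.finrank F V → weightIn H D ≤ x) :
    ∀ᶠ t : ℕ in Filter.atTop, ∃ M : Grass F V h → ℤ, (∀ U, 0 ≤ M U) ∧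
      weightIn ⊤ M = n + t * y ∧
      ∀ H : Submodule F V, Module.finrank F H + 1 = Module.finrank F V →
        weightIn H M ≤ s + t * x := by
  obtain ⟨K, C, hK, hCpos, hCtop, hC⟩ := exists_pos_combination hy hD hD'
  let B : ℕ := ∑ U, ((f U).natAbs + K * (D U).natAbs)
  -- Write `t = a + K b` with `a < K`. The witness is `f + a D + b C`: since `C ≥ 1` everywhere and
  -- `b ≥ B`, the last term outweighs every negative coefficient of the others.
  filter_upwards [Filter.eventually_ge_atTop (K * B)] with t ht
  have hb : B ≤ t / K := (Nat.le_div_iff_mul_le hK).2 (by rwa [mul_comm])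
  have hta : t % K + K * (t / K) = t := Nat.mod_add_div t K
  have ha : t % K < K := Nat.mod_lt _ hK
  have hta' : (t : ℤ) = (t % K : ℕ) + K * (t / K : ℕ) := by exact_mod_cast hta.symm
  generalize t / K = b at *
  generalize t % K = a at *
  refine ⟨f + (a : ℤ) • D + (b : ℤ) • C, fun U => ?_, ?_, fun H hH => ?_⟩
  · have h1 : (f U).natAbs + K * (D U).natAbs ≤ B :=
      Finset.single_le_sum (f := fun U => (f U).natAbs + K * (D U).natAbs)
        (fun _ _ => Nat.zero_le _) (Finset.mem_univ U)
    have h2 : a * (D U).natAbs ≤ K * (D U).natAbs := Nat.mul_le_mul_right _ ha.le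
    have h3 : b ≤ b * C U := le_mul_of_one_le_right (by positivity) (hCpos U)
    have h4 : (((f U).natAbs + a * (D U).natAbs : ℕ) : ℤ) ≤ b := by
      exact_mod_cast (by omega : (f U).natAbs + a * (D U).natAbs ≤ b)
    push_cast at h4
    have h5 : -(a * |D U|) ≤ a * D U := by
      rw [← mul_neg]
      exact mul_le_mul_of_nonneg_left (neg_abs_le _) (by positivity)
    have h6 := neg_abs_le (f U)
    simp only [Pi.add_apply, Pi.smul_apply, smul_eq_mul]
    linarith
  · simp only [map_add, map_smul, smul_eq_mul, hf, hD, hCtop, hta']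
    ring
  · have h1 := mul_le_mul_of_nonneg_left (hD' H hH) (Int.natCast_nonneg a)
    have h2 := mul_le_mul_of_nonneg_left (hC H hH) (Int.natCast_nonneg b)
    have h3 := hf' H hH
    simp only [map_add, map_smul, smul_eq_mul, hta']
    linarith

end Averaging

/-! ### Basic combinations attached to a flag -/

section Flag

variable {F : Type*} [Field F] {V : Type*} [AddCommGroup V] [Module F V] {h : ℕ}

theorem exists_monotone_finrank_eq [FiniteDimensional F V] :
    ∃ E : ℕ → Submodule F V, Monotone E ∧ ∀ i ≤ Module.finrank F V, Module.finrank F (E i) = i := by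
  let b := Module.finBasis F V
  refine ⟨fun i => Submodule.span F {v | ∃ j : Fin (Module.finrank F V), (j : ℕ) < i ∧ b j = v},
    fun i i' hi => Submodule.span_mono ?_, fun i hi => ?_⟩
  · rintro _ ⟨j, hj, rfl⟩
    exact ⟨j, hj.trans_le hi, rfl⟩
  · have h1 : {v | ∃ j : Fin (Module.finrank F V), (j : ℕ) < i ∧ b j = v} = Set.range (b ∘ Fin.castLE hi) := by
      ext v
      constructor
      · rintro ⟨j, hj, rfl⟩
        exact ⟨⟨j, hj⟩, rfl⟩
      · rintro ⟨j, rfl⟩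
        exact ⟨Fin.castLE hi j, j.2, rfl⟩
    change Module.finrank F (Submodule.span F
      {v | ∃ j : Fin (Module.finrank F V), (j : ℕ) < i ∧ b j = v}) = i
    rw [h1, finrank_span_eq_card (b.linearIndependent.comp _ (Fin.castLE_injective hi)),
      Fintype.card_fin]

variable [Finite F] [FiniteDimensional F V] [Fintype (Grass F V h)]

/-- For a flag with members `A` of dimension `h - 1` and `E j` of dimension `h + j`, `S j` is the
sum of the `h`-subspaces between `A` and `E j`, and `Q` is `[h]_q` times `S 1` minus the sum of all
`h`-subspaces of `E 1`. -/
theorem exists_flag_combinations {q k : ℕ} (hq : Nat.card F = q) (hh : 1 ≤ h) (hk : 1 ≤ k)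
    (hV : Module.finrank F V = h + k) :
    ∃ (S : ℕ → Grass F V h → ℤ) (Q : Grass F V h → ℤ),
      (∀ j ≤ k, weightIn ⊤ (S j) = qNum q (j + 1)) ∧ weightIn ⊤ Q = qNum q h - 1 ∧
      ∀ H : Submodule F V, Module.finrank F H + 1 = Module.finrank F V →
        ((∀ j ≤ k, weightIn H (S j) = 0) ∧ weightIn H Q = -1) ∨
        (weightIn H Q = qNum q h - 1 ∧ ∃ i ≤ k, ∀ j ≤ k,
          weightIn H (S j) = if j < i then (qNum q (j + 1) : ℤ) else qNum q j) := by
  have hq2 : 2 ≤ q := hq ▸ Finite.one_lt_card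
  obtain ⟨E, hE, hEr⟩ := exists_monotone_finrank_eq (F := F) (V := V)
  have hA : Module.finrank F (E (h - 1)) + 1 = h := by rw [hEr _ (by omega)]; omega
  have hAE : ∀ j, E (h - 1) ≤ E (h + j) := fun j => hE (by omega)
  have hE1 : h + 1 = Module.finrank F (E (h + 1)) := (hEr _ (by omega)).symm
  have hS1 : ∀ (H : Submodule F V) j, j ≤ k → E (h - 1) ≤ H → E (h + j) ≤ H →
      weightIn H (interval h (E (h - 1)) (E (h + j))) = qNum q (j + 1) := by
    intro H j hj h1 h2
    rw [weightIn_interval_of_le hA (hAE j) h1, inf_eq_left.2 h2, hEr _ (by omega), hq]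
    congr 2; omega
  have hrec1 : (qNum q (h + 1) : ℤ) = q * qNum q h + 1 := by exact_mod_cast qNum_succ' hq2 h
  have hrec2 : (qNum q (1 + 1) : ℤ) = q + 1 := by
    rw [qNum_succ' hq2, qNum_one hq2]; simp
  have hQ1 : ∀ H : Submodule F V, E (h - 1) ≤ H → E (h + 1) ≤ H →
      weightIn H ((qNum q h : ℤ) • interval h (E (h - 1)) (E (h + 1)) -
        interval h ⊥ (E (h + 1))) = qNum q h - 1 := by
    intro H h1 h2
    rw [map_sub, map_smul, hS1 H 1 hk h1 h2, weightIn_interval_bot_of_le hE1 h2, hq, smul_eq_mul,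
      hrec1, hrec2]
    ring
  refine ⟨fun j => interval h (E (h - 1)) (E (h + j)),
    (qNum q h : ℤ) • interval h (E (h - 1)) (E (h + 1)) - interval h ⊥ (E (h + 1)),
    fun j hj => hS1 ⊤ j hj le_top le_top, hQ1 ⊤ le_top le_top, fun H hH => ?_⟩
  by_cases hAH : E (h - 1) ≤ H
  · right
    have hS2 : ∀ j, j ≤ k → ¬ E (h + j) ≤ H →
        weightIn H (interval h (E (h - 1)) (E (h + j))) = qNum q j := by
      intro j hj h2
      have := finrank_inf_hyperplane hH h2
      rw [hEr _ (by omega)] at this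
      rw [weightIn_interval_of_le hA (hAE j) hAH, hq]
      congr 2; omega
    refine ⟨?_, ?_⟩
    · by_cases h2 : E (h + 1) ≤ H
      · exact hQ1 H hAH h2
      -- Here `S 1` contributes only `E h`, and `E h` is also the only `h`-subspace of `E (h + 1)`
      -- lying in `H`.
      · rw [map_sub, map_smul, hS2 1 hk h2, weightIn_interval_bot_of_not_le hE1 hH h2,
          qNum_one hq2]
        simp
    · have hex : ∃ j, ¬ E (h + j) ≤ H := ⟨k, fun hle => by
        have := Submodule.finrank_mono hle
        rw [hEr _ hV.ge] at this
        omega⟩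
      classical
      have hfind : ∀ j, E (h + j) ≤ H ↔ j < Nat.find hex := fun j =>
        ⟨fun h1 => lt_of_not_ge fun h2 =>
          Nat.find_spec hex ((hE (Nat.add_le_add_left h2 h)).trans h1),
        fun h1 => not_not.1 (Nat.find_min hex h1)⟩
      -- The index `i` is that of the first flag member outside `H`; `i ≤ k` because `E (h + k)` is
      -- the whole space.
      refine ⟨Nat.find hex, Nat.find_min' hex fun hle => ?_, fun j hj => ?_⟩
      · have := Submodule.finrank_mono hle
        rw [hEr _ hV.ge] at this
        omega
      · simp only [← hfind]
        split_ifs with h1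
        · exact hS1 H j hj hAH h1
        · exact hS2 j hj h1
  · left
    have h2 : ¬ E (h + 1) ≤ H := fun h2 => hAH ((hAE 1).trans h2)
    refine ⟨fun j _ => weightIn_interval_of_not_le hAH, ?_⟩
    rw [map_sub, map_smul, weightIn_interval_of_not_le hAH,
      weightIn_interval_bot_of_not_le hE1 hH h2]
    simp

/-- An integral combination with the parameters prescribed by the Griesmer bound. -/
theorem exists_combination_of_sum_le {q k m s : ℕ} {c : ℕ → ℕ} (hq : Nat.card F = q)
    (hh : 1 ≤ h) (hk : 1 ≤ k) (hV : Module.finrank F V = h + k)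
    (hc : ∀ j, m ≤ q ^ (j + 1) * c j)
    (hsum : ∑ j ∈ Finset.range k, c j ≤ s * qNum q h) :
    ∃ f : Grass F V h → ℤ, weightIn ⊤ f = m + s ∧
      ∀ H : Submodule F V, Module.finrank F H + 1 = Module.finrank F V → weightIn H f ≤ s := by
  have hq2 : 2 ≤ q := hq ▸ Finite.one_lt_card
  obtain ⟨S, Q, hS, hQ, hH⟩ := exists_flag_combinations (V := V) hq hh hk hV
  have hrec : ∀ j, (qNum q (j + 1) : ℤ) = q * qNum q j + 1 := fun j => by
    exact_mod_cast qNum_succ' hq2 j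
  have hrec' : ∀ j, (qNum q (j + 1) : ℤ) = qNum q j + q ^ j := fun j => by
    exact_mod_cast qNum_succ hq2 j
  have h0 : qNum q 0 = 0 := qNum_zero q
  have h1 : qNum q (0 + 1) = 1 := qNum_one hq2
  have hsum' : (∑ j ∈ Finset.range k, (c j : ℤ)) ≤ s * qNum q h := by exact_mod_cast hsum
  -- Each `S (j + 1) - q S j` has total 1. Its weight in a hyperplane containing `A` is also 1,
  -- except that it drops to `1 - q^(j+1)` when `i = j + 1`. Subtracting `s Q` gives weight `s` in
  -- hyperplanes not containing `A`, and the multiple of `S 0` adjusts the total.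
  refine ⟨(m + (s * qNum q h - ∑ j ∈ Finset.range k, (c j : ℤ))) • S 0 +
    ∑ j ∈ Finset.range k, (c j : ℤ) • (S (j + 1) - (q : ℤ) • S j) - (s : ℤ) • Q, ?_, ?_⟩
  · have : ∀ j ∈ Finset.range k, (c j : ℤ) * (weightIn ⊤ (S (j + 1)) - q * weightIn ⊤ (S j)) = c j :=
      fun j hj => by
        rw [hS (j + 1) (Finset.mem_range.1 hj), hS j (Finset.mem_range.1 hj).le, hrec (j + 1)]
        ring
    simp only [map_sub, map_add, map_smul, map_sum, smul_eq_mul, hQ]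
    rw [hS 0 (by omega), h1, Finset.sum_congr rfl this]
    push_cast
    ring
  · intro H hHr
    simp only [map_sub, map_add, map_smul, map_sum, smul_eq_mul]
    rcases hH H hHr with ⟨hz, hQH⟩ | ⟨hQH, i, hik, hi⟩
    · have : ∀ j ∈ Finset.range k,
          (c j : ℤ) * (weightIn H (S (j + 1)) - q * weightIn H (S j)) = 0 := fun j hj => by
        rw [hz (j + 1) (Finset.mem_range.1 hj), hz j (Finset.mem_range.1 hj).le]; ring
      rw [hQH, hz 0 (by omega), Finset.sum_eq_zero this]
      simp
    · have key : ∀ j ∈ Finset.range k, (c j : ℤ) * (weightIn H (S (j + 1)) - q * weightIn H (S j)) =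
          c j - if j + 1 = i then (q ^ (j + 1) * c j : ℤ) else 0 := by
        intro j hj
        rw [hi (j + 1) (Finset.mem_range.1 hj), hi j (Finset.mem_range.1 hj).le]
        split_ifs <;> first | omega | skip
        · rw [hrec (j + 1)]; ring
        · linear_combination (-(c j : ℤ)) * (hrec' (j + 1)) + (c j : ℤ) * hrec (j + 1)
        · rw [hrec j]; ring
      rw [Finset.sum_congr rfl key, Finset.sum_sub_distrib, hQH, hi 0 (by omega), h0, h1]
      -- For `i = 0` the term `S 0` vanishes and `hsum` gives the bound. For `i > 0` the drop `q^i c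
      -- (i - 1)` absorbs `m` by `hc`.
      rcases Nat.eq_zero_or_pos i with rfl | hi0
      · simp
        linarith
      · obtain ⟨i, rfl⟩ := Nat.exists_eq_add_of_le' hi0
        have hci : (m : ℤ) ≤ q ^ (i + 1) * c i := by exact_mod_cast hc i
        simp only [Nat.add_right_cancel_iff, Finset.sum_ite_eq', Finset.mem_range,
          if_pos (show i < k by omega), if_pos hi0]
        push_cast
        linarith

/-- An integral combination with the parameters of a design with constant hyperplane weights. -/
theorem exists_design_combination {q k x y : ℕ} (hq : Nat.card F = q) (hh : 1 ≤ h) (hk : 1 ≤ k)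
    (hV : Module.finrank F V = h + k) (hxy : y * qNum q k = x * qNum q h) :
    ∃ D : Grass F V h → ℤ, weightIn ⊤ D = y * q ^ k + x ∧
      ∀ H : Submodule F V, Module.finrank F H + 1 = Module.finrank F V → weightIn H D ≤ x := by
  have hq2 : 2 ≤ q := hq ▸ Finite.one_lt_card
  obtain ⟨S, Q, hS, hQ, hH⟩ := exists_flag_combinations (V := V) hq hh hk hV
  have hxy' : (y * qNum q k : ℤ) = x * qNum q h := by exact_mod_cast hxy
  have hrec' : (qNum q (k + 1) : ℤ) = qNum q k + q ^ k := by exact_mod_cast qNum_succ hq2 k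
  -- The weight is `x` in every hyperplane: those not containing `A` see only `-x Q`, the others see
  -- `y [k]_q - x ([h]_q - 1) = x`.
  refine ⟨(y : ℤ) • S k - (x : ℤ) • Q, ?_, fun H hHr => ?_⟩
  · rw [map_sub, map_smul, map_smul, hQ, hS k le_rfl, hrec', smul_eq_mul, smul_eq_mul]
    linear_combination hxy'
  · rw [map_sub, map_smul, map_smul, smul_eq_mul, smul_eq_mul]
    rcases hH H hHr with ⟨hz, hQH⟩ | ⟨hQH, i, hik, hi⟩
    · rw [hQH, hz k le_rfl]; simp
    · rw [hQH, hi k le_rfl, if_neg (by omega)]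
      linarith

end Flag

/-! ### Projective systems -/

section Systems

variable {F : Type*} [Field F] {r h : ℕ}

theorem numContained_cons (S : Multiset (Submodule F (Fin r → F))) (U H : Submodule F (Fin r → F)) :
    (U ≤ H → numContained (U ::ₘ S) H = numContained S H + 1) ∧
      (¬ U ≤ H → numContained (U ::ₘ S) H = numContained S H) :=
  ⟨fun h => by simp [numContained, h], fun h => by simp [numContained, h]⟩

/-- If all hyperplanes contain at most `s` elements, then elements can be moved into a fixed
hyperplane until the bound `s` is attained. -/
theorem exists_isFaithfulProjectiveSystem {n s : ℕ} (hr : h < r) (hsn : s ≤ n)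
    {S : Multiset (Submodule F (Fin r → F))} (hcard : Multiset.card S = n)
    (hfin : ∀ U ∈ S, Module.finrank F U = h)
    (hle : ∀ H : Submodule F (Fin r → F), Module.finrank F H + 1 = r → numContained S H ≤ s) :
    ∃ S, IsFaithfulProjectiveSystem F h n r s S := by
  classical
  obtain ⟨E, hE, hEr⟩ := exists_monotone_finrank_eq (F := F) (V := Fin r → F)
  rw [Module.finrank_fin_fun] at hEr
  have hH0 : Module.finrank F (E (r - 1)) + 1 = r := by rw [hEr _ (by omega)]; omega
  have hU0 : E h ≤ E (r - 1) := hE (by omega)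
  induction hd : s - numContained S (E (r - 1)) using Nat.strong_induction_on generalizing S with
  | _ d ih =>
  by_cases hex : ∃ H : Submodule F (Fin r → F), Module.finrank F H + 1 = r ∧ numContained S H = s
  · exact ⟨S, ⟨hcard, fun U hU => (hfin U hU).le, hle, hex⟩, hfin⟩
  · have hlt : ∀ H : Submodule F (Fin r → F), Module.finrank F H + 1 = r →
        numContained S H < s := fun H hH => lt_of_le_of_ne (hle H hH) fun h => hex ⟨H, hH, h⟩
    have hU : ∃ U ∈ S, ¬ U ≤ E (r - 1) := by
      by_contra! hall
      have := hlt _ hH0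
      rw [numContained, Multiset.countP_eq_card.2 hall] at this
      omega
    obtain ⟨U, hUS, hU⟩ := hU
    obtain ⟨S, rfl⟩ := Multiset.exists_cons_of_mem hUS
    have h0 := hlt _ hH0
    have h1 := (numContained_cons S U _).2 hU
    have h2 := (numContained_cons S (E h) _).1 hU0
    -- Replacing `U` by `E h` raises any hyperplane count by at most one, which is safe as all
    -- counts are below `s`. The count in `E (r - 1)` rises, so the process ends.
    refine ih _ ?_ (S := E h ::ₘ S) ?_ ?_ ?_ rfl
    · omega
    · simpa using hcard
    · intro W hW
      rcases Multiset.mem_cons.1 hW with rfl | hW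
      · exact hEr _ hr.le
      · exact hfin W (Multiset.mem_cons_of_mem hW)
    · intro H hH
      have h3 := hlt H hH
      have h4 := numContained_cons S U H
      have h5 := numContained_cons S (E h) H
      by_cases a : U ≤ H <;> by_cases b : E h ≤ H <;> simp only [a, b, not_true_eq_false,
        not_false_eq_true, true_imp_iff, false_imp_iff, and_true, true_and] at h4 h5 <;> omega

theorem exists_multiset_of_combination [Fintype (Grass F (Fin r → F) h)]
    {M : Grass F (Fin r → F) h → ℤ} (hM : ∀ U, 0 ≤ M U) :
    ∃ S : Multiset (Submodule F (Fin r → F)), (∀ U ∈ S, Module.finrank F U = h) ∧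
      (Multiset.card S : ℤ) = weightIn ⊤ M ∧ ∀ H, (numContained S H : ℤ) = weightIn H M := by
  classical
  have key : ∀ H, (numContained (∑ U, Multiset.replicate (M U).toNat U.1) H : ℤ) =
      weightIn H M := fun H => by
    rw [weightIn_apply, numContained, ← Multiset.coe_countPAddMonoidHom, map_sum, Nat.cast_sum]
    refine Finset.sum_congr rfl fun U _ => ?_
    have hP : ∀ V ∈ Multiset.replicate (M U).toNat U.1, V = U.1 :=
      fun _ => Multiset.eq_of_mem_replicate
    rw [Multiset.coe_countPAddMonoidHom]
    split_ifs with hUH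
    · rw [Multiset.countP_eq_card.2 fun V hV => hP V hV ▸ hUH, Multiset.card_replicate,
        Int.toNat_of_nonneg (hM U)]
    · rw [Multiset.countP_eq_zero.2 fun V hV => hP V hV ▸ hUH, Nat.cast_zero]
  refine ⟨∑ U, Multiset.replicate (M U).toNat U.1, fun U hU => ?_, ?_, key⟩
  · obtain ⟨W, _, hW⟩ := Multiset.mem_sum.1 hU
    rw [Multiset.eq_of_mem_replicate hW]
    exact W.2
  · rw [← key ⊤, numContained, Multiset.countP_eq_card.2 fun _ _ => le_top]

end Systems

/-! ### Assembly of the theorem -/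

theorem mainTheorem3 {F : Type*} [Field F] [Finite F] (q : ℕ) (hq : Nat.card F = q)
    (n r s h : ℕ) (hs : 1 ≤ s) (hn : s < n) (hh : 1 ≤ h) (hr : h < r)
    (hsurplus : 0 ≤ surplus n r s h q) :
    ∀ᶠ t : ℕ in Filter.atTop, ∃ S : Multiset (Submodule F (Fin r → F)),
      IsFaithfulProjectiveSystem F h
        (n + t * (qNum q r / qNum q (Nat.gcd r h))) r
        (s + t * (qNum q (r - h) / qNum q (Nat.gcd r h))) S := by
  have hq2 : 2 ≤ q := hq ▸ Finite.one_lt_card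
  have := Fintype.ofFinite (Grass F (Fin r → F) h)
  obtain ⟨k, rfl⟩ := Nat.exists_eq_add_of_le hr.le
  have hk : 1 ≤ k := by omega
  obtain ⟨m, rfl⟩ := Nat.exists_eq_add_of_le hn.le
  have hV : Module.finrank F (Fin (h + k) → F) = h + k := Module.finrank_fin_fun F
  have hsum : ∑ j ∈ Finset.range k, m ⌈/⌉ q ^ (j + 1) ≤ s * qNum q h := by
    obtain ⟨h, rfl⟩ := Nat.exists_eq_add_of_le' hh
    rw [surplus, Nat.add_sub_cancel_left, Nat.add_sub_cancel, griesmer_pow_mul hq2, sub_nonneg,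
      Nat.cast_le] at hsurplus
    linarith
  obtain ⟨f, hf, hf'⟩ := exists_combination_of_sum_le hq hh hk hV
    (fun j => by simpa using le_smul_ceilDiv (a := q ^ (j + 1)) (b := m) (by positivity)) hsum
  have hg : 0 < qNum q (Nat.gcd (h + k) h) := qNum_pos hq2 (Nat.gcd_pos_of_pos_right _ hh)
  obtain ⟨y, hy⟩ := qNum_dvd_qNum hq2 (Nat.gcd_dvd_right (h + k) h)
  obtain ⟨x, hx⟩ := qNum_dvd_qNum hq2 (show Nat.gcd (h + k) h ∣ k from
    (Nat.dvd_add_right (Nat.gcd_dvd_right (h + k) h)).1 (Nat.gcd_dvd_left (h + k) h))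
  -- With `y = [h]_q / [g]_q` and `x = [k]_q / [g]_q`, the total of `D` is the required `[r]_q /
  -- [g]_q`.
  have hr' : qNum q (h + k) = qNum q (Nat.gcd (h + k) h) * (y * q ^ k + x) := by
    rw [add_comm h k, qNum_add hq2, add_comm k h]
    linear_combination q ^ k * hy + hx
  obtain ⟨D, hD, hD'⟩ := exists_design_combination (x := x) (y := y) hq hh hk hV (by
    rw [hx, hy]; ring)
  have hypos : 0 < y := Nat.pos_of_ne_zero fun h0 => by
    have := qNum_pos hq2 hh
    rw [hy, h0] at this
    exact lt_irrefl _ this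
  rw [Nat.add_sub_cancel_left, hr', Nat.mul_div_cancel_left _ hg, hx, Nat.mul_div_cancel_left _ hg]
  filter_upwards [eventually_exists_nonneg_combination (by positivity) hf hf' hD hD']
    with t ⟨M, hM, hMtop, hMH⟩
  obtain ⟨S, hSfin, hScard, hS⟩ := exists_multiset_of_combination hM
  refine exists_isFaithfulProjectiveSystem hr ?_ (S := S) ?_ hSfin fun H hH => ?_
  · exact Nat.add_le_add (Nat.le_add_right _ _) (Nat.mul_le_mul_left _ (Nat.le_add_left _ _))
  · rw [hMtop] at hScard
    zify
    linarith
  · have := hMH H (by rw [hH, hV])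
    rw [← hS] at this
    exact_mod_cast this
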